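/- Let $(\xi_n)_{n\in\mathbb{Z}}$ be a real-valued stationary centered Gaussian sequence such that \[ \sum_{j=1}^n\sum_{k=1}^n \mathbb{E}\,\xi_j\xi_k \sim n^{2H}\ell(n), \qquad n\to\infty, \] where $0<H<1$ and $\ell$ is slowly varying at infinity (i.e. $\ell$ is positive and measurable on some half-line $[X,\infty)$ and $\ell(ax)/\ell(x)\to 1$ as $x\to\infty$ for every $a>0$), and $f(n)\sim g(n)$ means $\lim_{n\to\infty} f(n)/g(n)=1$. Let $(S_n)_{n\in\mathbb{Z}}$ be given by $S_0:=0$ and $S_n-S_{n-1}:=\xi_n$ for all $n\in\mathbb{Z}$. Then there is a constant $c>0$ such that, for every integer $N\ge 1$, \[ c^{-1}N^{-1}\;\le\; \mathbb{P}\bigl(S_n\le 0 \text{ for all } n\in\mathbb{Z} \text{ with } |n|\le N\bigr)\;\le\; N^{-1}. \] -/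

import Mathlib

open MeasureTheory ProbabilityTheory Filter Topology

/-- `ℓ` is slowly varying at infinity: on some half-line `[X, ∞)` it is positive and measurable,
and `ℓ (a x) / ℓ x → 1` as `x → ∞`, for every fixed `a > 0`. -/
def IsSlowlyVarying (ℓ : ℝ → ℝ) : Prop :=
  (∃ X : ℝ, (∀ x ∈ Set.Ici X, 0 < ℓ x) ∧ Measurable (fun x : Set.Ici X => ℓ x)) ∧
    ∀ a : ℝ, 0 < a → Tendsto (fun x : ℝ => ℓ (a * x) / ℓ x) atTop (𝓝 1)

/-- A two-sided real sequence of random variables is (strictly) stationary: each of its shifts,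
as a random element of `ℤ → ℝ`, has the same law as the sequence itself. -/
def IsStationarySeq {Ω : Type*} [MeasurableSpace Ω] (ξ : ℤ → Ω → ℝ) (P : Measure Ω) : Prop :=
  ∀ m : ℤ, IdentDistrib (fun ω (n : ℤ) => ξ (n + m) ω) (fun ω (n : ℤ) => ξ n ω) P P

/-- The two-sided walk with increments `ξ` started at `0`: it is `ξ 1 + ⋯ + ξ n` for `n ≥ 0` and
`-(ξ (n + 1) + ⋯ + ξ 0)` for `n < 0`. -/
noncomputable def walk {Ω : Type*} (ξ : ℤ → Ω → ℝ) (n : ℤ) (ω : Ω) : ℝ :=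
  ∑ k ∈ Finset.Ioc 0 n, ξ k ω - ∑ k ∈ Finset.Ioc n 0, ξ k ω

theorem walk_zero {Ω : Type*} (ξ : ℤ → Ω → ℝ) (ω : Ω) : walk ξ 0 ω = 0 := by
  simp [walk]

theorem walk_sub_walk_pred {Ω : Type*} (ξ : ℤ → Ω → ℝ) (n : ℤ) (ω : Ω) :
    walk ξ n ω - walk ξ (n - 1) ω = ξ n ω := by
  unfold walk
  rcases le_or_gt 1 n with h | h
  · have h1 : Finset.Ioc 0 n = insert n (Finset.Ioc 0 (n - 1)) := by
      ext k; simp only [Finset.mem_Ioc, Finset.mem_insert]; omega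
    have h2 : Finset.Ioc n 0 = ∅ := Finset.Ioc_eq_empty (by omega)
    have h3 : Finset.Ioc (n - 1) 0 = ∅ := Finset.Ioc_eq_empty (by omega)
    rw [h1, h2, h3, Finset.sum_insert (by simp)]
    simp
  · have h1 : Finset.Ioc (n - 1) 0 = insert n (Finset.Ioc n 0) := by
      ext k; simp only [Finset.mem_Ioc, Finset.mem_insert]; omega
    have h2 : Finset.Ioc 0 n = ∅ := Finset.Ioc_eq_empty (by omega)
    have h3 : Finset.Ioc 0 (n - 1) = ∅ := Finset.Ioc_eq_empty (by omega)
    rw [h1, h2, h3, Finset.sum_insert (by simp)]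
    simp

/-!
Write `S` for the walk, `V n` for the variance of `S n`, and `p N` for the probability that `S ≤ 0` on
`[-N, N]`. By stationarity of the increments, `p N` is also the probability that `S k` is the maximum
of `S` over `[k - N, k + N]`, for every `k`.

Upper bound (`persistence_le_inv`): for `k` in a window of length `N` these events are almost surely
disjoint, because two different sites of the window cannot both be maximal unless `S` takes the same
value there, which is a null event as long as `V` does not vanish. So `N * p N ≤ 1`. That `V` does
not vanish follows from `V (2 * n) ≤ 4 * V n` and the assumed asymptotics
(`pos_of_tendsto_of_le_four_mul`).

Lower bound (`exists_dyadic_persistence_ge`): as `p` is nonincreasing, only `N = 2 ^ n` matters. Take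
`M = 2 ^ (n + e)` with `e` fixed. If the maximum of `S` over `[0, M]` lies at distance at least `N`
from both endpoints, one of the `M` events above occurs; so `M * p N` is at least the probability of
that, and it suffices to bound this probability below. Regular variation enters only through
`V (2 * n) / V n → 4 ^ H`, in two ways.

* As `4 ^ H < 4`, the midpoint is high with positive probability (`exists_midpoint_bound`): the
  variables `D = 2 * S (M / 2) - S M` and `T = S M` are independent Gaussians, the variance of `D` is
  at least a fixed multiple of that of `T`, and `D > |T| + 2 * x` says that `S (M / 2)` exceeds
  `max 0 (S M)` by more than `x`. Here `x` is the standard deviation of `S M`.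
* As `4 ^ H > 1`, the variances at dyadic times grow geometrically. Dyadic chaining with moments of
  high order (`exists_chaining_bound`) then shows that within distance `N` of the endpoints of
  `[0, M]` the walk moves by more than `x` only with a probability that tends to `0` as `e → ∞`.
-/

/-! ### Increments of the walk: stationarity, Gaussianity, variances -/

theorem walk_add_sub_walk {Ω : Type*} (ξ : ℤ → Ω → ℝ) (m n : ℤ) (ω : Ω) :
    walk ξ (m + n) ω - walk ξ m ω = walk (fun k => ξ (k + m)) n ω := by
  induction n using Int.induction_on with
  | zero => simp [walk_zero]
  | succ i ih =>
    have h1 := walk_sub_walk_pred ξ (m + (i + 1)) ω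
    have h2 := walk_sub_walk_pred (fun k => ξ (k + m)) (i + 1) ω
    rw [show m + ((i : ℤ) + 1) - 1 = m + i by ring] at h1
    rw [show (i : ℤ) + 1 - 1 = i by ring] at h2
    rw [show (i : ℤ) + 1 + m = m + (i + 1) by ring] at h2
    linarith
  | pred i ih =>
    have h1 := walk_sub_walk_pred ξ (m + -i) ω
    have h2 := walk_sub_walk_pred (fun k => ξ (k + m)) (-i) ω
    rw [show m + -(i : ℤ) - 1 = m + (-i - 1) by ring] at h1
    rw [show -(i : ℤ) + m = m + -i by ring] at h2
    linarith

section Walk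

variable {Ω : Type*} [MeasurableSpace Ω] {P : Measure Ω} {ξ : ℤ → Ω → ℝ}

theorem IsStationarySeq.identDistrib_walk (hstat : IsStationarySeq ξ P) (m : ℤ) :
    IdentDistrib (fun ω (n : ℤ) => walk ξ (m + n) ω - walk ξ m ω) (fun ω n => walk ξ n ω) P P := by
  have hu : Measurable (fun (x : ℤ → ℝ) (n : ℤ) => walk (fun k (y : ℤ → ℝ) => y k) n x) := by
    unfold walk
    fun_prop
  have := (hstat m).comp hu
  simp_rw [walk_add_sub_walk]
  exact this

theorem IsStationarySeq.identDistrib_walk_sub (hstat : IsStationarySeq ξ P) (m n : ℤ) :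
    IdentDistrib (fun ω => walk ξ (m + n) ω - walk ξ m ω) (walk ξ n) P P :=
  (hstat.identDistrib_walk m).comp (measurable_pi_apply n)

theorem isGaussianProcess_walk (hgauss : IsGaussianProcess ξ P) :
    IsGaussianProcess (walk ξ) P := by
  refine hgauss.of_isGaussianProcess fun n => ⟨Finset.Ioc 0 n ∪ Finset.Ioc n 0,
    ∑ k : (Finset.Ioc 0 n ∪ Finset.Ioc n 0 : Finset ℤ),
      (if (0 : ℤ) < k then (1 : ℝ) else -1) • ContinuousLinearMap.proj k, fun ω => ?_⟩
  have hd : Disjoint (Finset.Ioc 0 n) (Finset.Ioc n 0) := by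
    rw [Finset.disjoint_left]
    intro k; simp only [Finset.mem_Ioc]; omega
  simp only [sum_apply, smul_apply,
    ContinuousLinearMap.proj_apply, Finset.restrict]
  rw [Finset.sum_coe_sort (Finset.Ioc 0 n ∪ Finset.Ioc n 0)
    (fun k : ℤ => (if (0 : ℤ) < k then (1 : ℝ) else -1) • ξ k ω), Finset.sum_union hd, _root_.walk,
    sub_eq_add_neg, ← Finset.sum_neg_distrib]
  congr 1
  · refine Finset.sum_congr rfl fun k hk => ?_
    rw [if_pos (Finset.mem_Ioc.1 hk).1, one_smul]
  · refine Finset.sum_congr rfl fun k hk => ?_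
    rw [if_neg (Finset.mem_Ioc.1 hk).2.not_gt, neg_one_smul]

theorem integral_walk (hgauss : IsGaussianProcess ξ P) (hcent : ∀ n : ℤ, ∫ ω, ξ n ω ∂P = 0)
    (n : ℤ) : ∫ ω, walk ξ n ω ∂P = 0 := by
  have hi : ∀ k, Integrable (ξ k) P := fun k => (hgauss.hasGaussianLaw_eval k).integrable
  unfold walk
  rw [integral_sub (integrable_finsetSum _ fun k _ => hi k)
    (integrable_finsetSum _ fun k _ => hi k), integral_finsetSum _ fun k _ => hi k,
    integral_finsetSum _ fun k _ => hi k]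
  simp [hcent]

theorem variance_walk_sub (hstat : IsStationarySeq ξ P) (a b : ℤ) :
    Var[fun ω => walk ξ a ω - walk ξ b ω; P] = Var[walk ξ (a - b).natAbs; P] := by
  rcases le_total b a with h | h
  · obtain ⟨n, rfl⟩ := Int.le.dest h
    rw [(hstat.identDistrib_walk_sub b n).variance_eq]
    simp
  · obtain ⟨n, rfl⟩ := Int.le.dest h
    rw [← variance_fun_neg]
    simp_rw [neg_sub]
    rw [(hstat.identDistrib_walk_sub a n).variance_eq]
    simp

theorem map_walk_sub (hgauss : IsGaussianProcess ξ P) (hcent : ∀ n : ℤ, ∫ ω, ξ n ω ∂P = 0)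
    (hstat : IsStationarySeq ξ P) (a b : ℤ) :
    P.map (fun ω => walk ξ a ω - walk ξ b ω) =
      gaussianReal 0 Var[walk ξ (a - b).natAbs; P].toNNReal := by
  have hw := isGaussianProcess_walk hgauss
  rw [(hw.hasGaussianLaw_fun_sub (s := a) (t := b)).map_eq_gaussianReal, variance_walk_sub hstat,
    integral_sub (hw.hasGaussianLaw_eval a).integrable (hw.hasGaussianLaw_eval b).integrable,
    integral_walk hgauss hcent, integral_walk hgauss hcent, sub_zero]

theorem variance_walk_eq_sum (hgauss : IsGaussianProcess ξ P)
    (hcent : ∀ n : ℤ, ∫ ω, ξ n ω ∂P = 0) (n : ℕ) :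
    Var[walk ξ n; P] =
      ∑ j ∈ Finset.Icc 1 n, ∑ k ∈ Finset.Icc 1 n, ∫ ω, ξ (j : ℤ) ω * ξ (k : ℤ) ω ∂P := by
  have := hgauss.isProbabilityMeasure
  have h : walk ξ (n : ℤ) = ∑ k ∈ Finset.Icc 1 n, ξ (k : ℤ) := by
    ext ω
    have hE : Finset.Ioc 0 (n : ℤ) = (Finset.Icc 1 n).map Nat.castEmbedding := by
      ext k
      simp only [Finset.mem_Ioc, Finset.mem_map, Finset.mem_Icc, Nat.castEmbedding_apply]
      constructor
      · intro hk
        exact ⟨k.toNat, by omega, by omega⟩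
      · rintro ⟨a, ha, rfl⟩
        omega
    rw [walk, hE, Finset.sum_map, Finset.Ioc_eq_empty (by omega)]
    simp
  rw [h, variance_sum' fun k _ => (hgauss.hasGaussianLaw_eval _).memLp_two]
  refine Finset.sum_congr rfl fun j _ => Finset.sum_congr rfl fun k _ => ?_
  simp [covariance, hcent]

/-- `D = 2 S_m - S_{2m}` is uncorrelated with `T = S_{2m}`, since `S_m` and `S_{2m} - S_m` have the
same variance; being jointly Gaussian, they are independent. -/
theorem indepFun_walk_midpoint (hgauss : IsGaussianProcess ξ P) (hstat : IsStationarySeq ξ P)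
    (m : ℕ) :
    IndepFun (fun ω => 2 * walk ξ m ω - walk ξ (2 * m) ω) (walk ξ (2 * m)) P := by
  have := hgauss.isProbabilityMeasure
  have hw := isGaussianProcess_walk hgauss
  have hL : ∀ n, MemLp (walk ξ n) 2 P := fun n => (hw.hasGaussianLaw_eval n).memLp_two
  refine HasGaussianLaw.indepFun_of_covariance_eq_zero ?_ ?_
  · have h2 := hw.hasGaussianLaw_prodMk (s := (m : ℤ)) (t := 2 * (m : ℤ))
    exact h2.map (((2 : ℝ) • ContinuousLinearMap.fst ℝ ℝ ℝ - ContinuousLinearMap.snd ℝ ℝ ℝ).prod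
      (ContinuousLinearMap.snd ℝ ℝ ℝ))
  · have h1 := variance_walk_sub hstat (2 * m) m
    rw [show (2 * (m : ℤ) - m).natAbs = m by omega, variance_fun_sub (hL _) (hL _),
      covariance_comm] at h1
    rw [covariance_fun_sub_left ((hL _).const_mul 2) (hL _) (hL _), covariance_const_mul_left,
      covariance_self (hL _).aestronglyMeasurable.aemeasurable]
    linarith

theorem variance_walk_midpoint (hgauss : IsGaussianProcess ξ P) (hstat : IsStationarySeq ξ P)
    (m : ℕ) :
    Var[fun ω => 2 * walk ξ m ω - walk ξ (2 * m) ω; P] =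
      4 * Var[walk ξ m; P] - Var[walk ξ (2 * m); P] := by
  have := hgauss.isProbabilityMeasure
  have hw := isGaussianProcess_walk hgauss
  have hL : ∀ n, MemLp (walk ξ n) 2 P := fun n => (hw.hasGaussianLaw_eval n).memLp_two
  have h1 := variance_walk_sub hstat (2 * m) m
  rw [show (2 * (m : ℤ) - m).natAbs = m by omega, variance_fun_sub (hL _) (hL _),
      covariance_comm] at h1
  rw [variance_fun_sub ((hL _).const_mul 2) (hL _), covariance_const_mul_left, variance_const_mul]
  linarith

end Walk

/-! ### Dyadic chaining for Gaussian increments -/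

theorem gaussianReal_eq_map_sqrt {v : ℝ} (hv : 0 ≤ v) :
    gaussianReal 0 v.toNNReal = (gaussianReal 0 1).map (fun z => √v * z) := by
  rw [gaussianReal_map_const_mul]
  congr 1
  · simp
  · ext
    simp [Real.sq_sqrt hv, hv]

theorem gaussianReal_real_pos_of_isOpen {s : Set ℝ} (hs : IsOpen s) (hne : s.Nonempty) :
    0 < (gaussianReal 0 1).real s := by
  rw [measureReal_def, ENNReal.toReal_pos_iff]
  refine ⟨pos_iff_ne_zero.2 fun h => ?_, measure_lt_top _ _⟩
  exact (hs.measure_pos volume hne).ne' (gaussianReal_absolutelyContinuous' 0 one_ne_zero h)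

/-- Markov's inequality for the moment of order `2q` of a centered Gaussian variable. -/
theorem gaussianReal_real_abs_gt_le (q : ℕ) : ∃ K : ℝ, 0 < K ∧ ∀ v t : ℝ, 0 ≤ v → 0 < t →
    (gaussianReal 0 v.toNNReal).real {x | t < |x|} ≤ K * (v / t ^ 2) ^ q := by
  have hint : Integrable (fun z : ℝ => z ^ (2 * q)) (gaussianReal 0 1) := by
    have := (memLp_id_gaussianReal' (μ := 0) (v := 1) (2 * q : ℕ)
      (ENNReal.natCast_ne_top _)).integrable_norm_pow'
    simpa only [id, Real.norm_eq_abs, (even_two_mul q).pow_abs] using this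
  refine ⟨∫ z, z ^ (2 * q) ∂gaussianReal 0 1 + 1, ?_, fun v t hv ht => ?_⟩
  · have : 0 ≤ ∫ z, z ^ (2 * q) ∂gaussianReal 0 1 :=
      integral_nonneg fun z => (even_two_mul q).pow_nonneg z
    linarith
  have hm : MeasurableSet {x : ℝ | t < |x|} := measurableSet_lt measurable_const (by fun_prop)
  rw [gaussianReal_eq_map_sqrt hv, map_measureReal_apply (by fun_prop) hm]
  have hmk := mul_meas_ge_le_integral_of_nonneg (μ := gaussianReal 0 1)
    (f := fun z => (v * z ^ 2) ^ q) (ae_of_all _ fun z => by positivity)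
    (by simp_rw [mul_pow, ← pow_mul]; exact hint.const_mul _) ((t ^ 2) ^ q)
  have hsub : (fun z => √v * z) ⁻¹' {x : ℝ | t < |x|} ⊆ {z | (t ^ 2) ^ q ≤ (v * z ^ 2) ^ q} := by
    intro z hz
    simp only [Set.mem_preimage, Set.mem_ofPred_eq] at hz ⊢
    have h2 : t ^ 2 ≤ v * z ^ 2 := by
      have := pow_le_pow_left₀ ht.le hz.le 2
      rwa [sq_abs, mul_pow, Real.sq_sqrt hv] at this
    gcongr
  have h1 := measureReal_mono (μ := gaussianReal 0 1) hsub
  have hI : ∫ z, (v * z ^ 2) ^ q ∂gaussianReal 0 1 = v ^ q * ∫ z, z ^ (2 * q) ∂gaussianReal 0 1 := by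
    simp_rw [mul_pow, ← pow_mul, integral_const_mul]
  rw [hI] at hmk
  rw [div_pow, ← mul_div_assoc, le_div_iff₀ (by positivity)]
  have hvq : 0 ≤ v ^ q := by positivity
  nlinarith [mul_le_mul_of_nonneg_left h1 (show 0 ≤ (t ^ 2) ^ q by positivity)]

/-- Dyadic chaining: if the increments of `f` over the dyadic intervals of length `2 ^ i` inside
`[0, 2 ^ n]` are at most `lam i`, then `f` stays within `∑ i < n, lam i` of its initial value. -/
theorem abs_sub_le_sum_of_dyadic (lam : ℕ → ℝ) (hlam : ∀ i, 0 ≤ lam i) (n : ℕ) :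
    ∀ f : ℕ → ℝ, (∀ i < n, ∀ l < 2 ^ (n - i), |f ((l + 1) * 2 ^ i) - f (l * 2 ^ i)| ≤ lam i) →
      ∀ k < 2 ^ n, |f k - f 0| ≤ ∑ i ∈ Finset.range n, lam i := by
  induction n with
  | zero =>
    intro f _ k hk
    simp_all
  | succ n ih =>
    intro f hf k hk
    rw [Finset.sum_range_succ]
    have hpow : ∀ i < n, 2 ^ (n + 1 - i) = 2 ^ (n - i) + 2 ^ (n - i) := fun i hi => by
      rw [Nat.succ_sub hi.le, pow_succ, mul_two]
    by_cases hkn : k < 2 ^ n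
    · have := ih f (fun i hi l hl => hf i (by omega) l (by rw [hpow i hi]; omega)) k hkn
      linarith [hlam n]
    · have h1 := ih (fun m => f (2 ^ n + m)) (fun i hi l hl => by
        have := hf i (by omega) (2 ^ (n - i) + l) (by rw [hpow i hi]; omega)
        have e : 2 ^ n = 2 ^ (n - i) * 2 ^ i := by rw [← pow_add]; congr 1; omega
        simp only [e, ← add_mul, ← add_assoc]
        exact this) (k - 2 ^ n) (by rw [pow_succ] at hk; omega)
      have h2 := hf n (by omega) 0 (by positivity)
      simp only [zero_add, one_mul, zero_mul] at h2
      simp only [add_zero, Nat.add_sub_cancel' (not_lt.1 hkn)] at h1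
      calc |f k - f 0| ≤ |f k - f (2 ^ n)| + |f (2 ^ n) - f 0| := abs_sub_le _ _ _
        _ ≤ _ := add_le_add h1 h2

/-- Maximal inequality from chaining. The variance `v i` of a dyadic increment of length `2 ^ i`
grows at least like `ρ ^ i` with `ρ > 1`, so for `q` large the moments of order `2q` beat the number
`2 ^ (n - i)` of increments at each level and only the coarsest level matters. -/
theorem exists_chaining_bound {ρ C : ℝ} (hρ : 1 < ρ) (hC : 0 < C) : ∃ (q : ℕ) (A : ℝ), q ≠ 0 ∧
    0 < A ∧ ∀ {Ω : Type*} [MeasurableSpace Ω] (P : Measure Ω) [IsProbabilityMeasure P]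
      (f : ℕ → Ω → ℝ) (v : ℕ → ℝ) (n : ℕ), (∀ i, 0 < v i) →
      (∀ i ≤ n, v i * ρ ^ (n - i) ≤ C * v n) →
      (∀ i l, P.map (fun ω => f ((l + 1) * 2 ^ i) ω - f (l * 2 ^ i) ω) =
        gaussianReal 0 (v i).toNNReal) →
      ∀ x : ℝ, 0 < x →
        P.real {ω | ∃ k < 2 ^ n, x < |f k ω - f 0 ω|} ≤ A * (v n / x ^ 2) ^ q := by
  -- `s` is chosen with `s < 1 < ρ s²`: thresholds proportional to `s ^ (n - i)` are summable, yet
  -- the ratio of variance to squared threshold still decays geometrically in `n - i`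
  obtain ⟨s, hs0, hs1, hsρ⟩ : ∃ s : ℝ, 0 < s ∧ s < 1 ∧ 1 < ρ * s ^ 2 := by
    have hs2 : (√(√ρ⁻¹)) ^ 2 = √ρ⁻¹ := Real.sq_sqrt (by positivity)
    have h1 : √ρ⁻¹ < 1 := by
      rw [Real.sqrt_lt' one_pos, one_pow]; exact inv_lt_one_of_one_lt₀ hρ
    refine ⟨√(√ρ⁻¹), by positivity, ?_, ?_⟩
    · rw [Real.sqrt_lt' one_pos, one_pow]; exact h1
    · rw [hs2]
      have h3 : 0 < √ρ⁻¹ := by positivity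
      have h4 : ρ * (√ρ⁻¹ * √ρ⁻¹) = 1 := by
        rw [Real.mul_self_sqrt (by positivity)]; field_simp
      nlinarith [mul_pos (by positivity : 0 < ρ) h3]
  obtain ⟨q, hq⟩ := pow_unbounded_of_one_lt 4 hsρ
  have hq0 : q ≠ 0 := by rintro rfl; norm_num at hq
  obtain ⟨K, hK, htail⟩ := gaussianReal_real_abs_gt_le q
  refine ⟨q, K * (C / (1 - s) ^ 2) ^ q, hq0, ?_, ?_⟩
  · have : 0 < 1 - s := by linarith
    positivity
  intro Ω _ P _ f v n hv hvC hlaw x hx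
  have h1s : 0 < 1 - s := by linarith
  set lam : ℕ → ℝ := fun i => x * (1 - s) * s ^ (n - i) with hlam
  have hlampos : ∀ i, 0 < lam i := fun i => by positivity
  have hsum : ∑ i ∈ Finset.range n, lam i ≤ x := by
    rw [hlam, ← Finset.mul_sum]
    have h1 : ∑ i ∈ Finset.range n, s ^ (n - i) ≤ 1 / (1 - s) := by
      calc ∑ i ∈ Finset.range n, s ^ (n - i) ≤ ∑ i ∈ Finset.range n, s ^ (n - 1 - i) :=
            Finset.sum_le_sum fun i _ => pow_le_pow_of_le_one hs0.le hs1.le (by omega)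
        _ = ∑ i ∈ Finset.range n, s ^ i := Finset.sum_range_reflect _ _
        _ ≤ 1 / (1 - s) := by
          rw [geom_sum_eq hs1.ne, ← neg_div_neg_eq, neg_sub, neg_sub]
          gcongr
          linarith [pow_pos hs0 n]
    calc x * (1 - s) * ∑ i ∈ Finset.range n, s ^ (n - i) ≤ x * (1 - s) * (1 / (1 - s)) := by gcongr
      _ = x := by field_simp
  have hsub : {ω | ∃ k < 2 ^ n, x < |f k ω - f 0 ω|} ⊆
      ⋃ i ∈ Finset.range n, ⋃ l ∈ Finset.range (2 ^ (n - i)),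
        {ω | lam i < |f ((l + 1) * 2 ^ i) ω - f (l * 2 ^ i) ω|} := by
    rintro ω ⟨k, hk, hxk⟩
    by_contra hcon
    simp only [Set.mem_iUnion, Finset.mem_range, Set.mem_ofPred_eq, not_exists, not_lt] at hcon
    have := abs_sub_le_sum_of_dyadic lam (fun i => (hlampos i).le) n (fun k => f k ω)
      (fun i hi l hl => hcon i hi l hl) k hk
    linarith
  have hone : ∀ i ∈ Finset.range n, ∀ l, P.real
      {ω | lam i < |f ((l + 1) * 2 ^ i) ω - f (l * 2 ^ i) ω|} ≤
        K * (C / (1 - s) ^ 2) ^ q * (v n / x ^ 2) ^ q * ((1 / 4) ^ (n - i)) := by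
    intro i hi l
    have hin := (Finset.mem_range.1 hi).le
    have hm : MeasurableSet {y : ℝ | lam i < |y|} := measurableSet_lt measurable_const (by fun_prop)
    have hae : AEMeasurable (fun ω => f ((l + 1) * 2 ^ i) ω - f (l * 2 ^ i) ω) P :=
      AEMeasurable.of_map_ne_zero (by rw [hlaw i l]; exact IsProbabilityMeasure.ne_zero _)
    have h1 := htail (v i) (lam i) (hv i).le (hlampos i)
    rw [← hlaw i l, measureReal_def, Measure.map_apply_of_aemeasurable hae hm] at h1
    refine h1.trans ?_
    have hfac : v i / lam i ^ 2 ≤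
        C / (1 - s) ^ 2 * (v n / x ^ 2) * (1 / (ρ * s ^ 2) ^ (n - i)) := by
      have hrhs : C / (1 - s) ^ 2 * (v n / x ^ 2) * (1 / (ρ * s ^ 2) ^ (n - i)) =
          (C * v n / ρ ^ (n - i)) / lam i ^ 2 := by
        simp only [hlam, mul_pow]
        rw [← pow_mul, ← pow_mul, mul_comm 2 (n - i)]
        field_simp
      rw [hrhs]
      gcongr
      rw [le_div_iff₀ (by positivity)]
      exact hvC i hin
    have h4 : (1 / (ρ * s ^ 2) ^ (n - i)) ^ q ≤ (1 / 4) ^ (n - i) := by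
      have e : (1 / (ρ * s ^ 2) ^ (n - i)) ^ q = (1 / (ρ * s ^ 2) ^ q) ^ (n - i) := by
        rw [div_pow, div_pow, one_pow, one_pow, ← pow_mul, ← pow_mul,
          mul_comm q]
      rw [e]
      gcongr
    have hpos : 0 ≤ v i / lam i ^ 2 := by have := hv i; positivity
    calc K * (v i / lam i ^ 2) ^ q
        ≤ K * (C / (1 - s) ^ 2 * (v n / x ^ 2) * (1 / (ρ * s ^ 2) ^ (n - i))) ^ q := by gcongr
      _ = K * (C / (1 - s) ^ 2) ^ q * (v n / x ^ 2) ^ q * (1 / (ρ * s ^ 2) ^ (n - i)) ^ q := by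
        rw [mul_pow, mul_pow]; ring
      _ ≤ _ := by
        have := hv n
        gcongr
  set B := K * (C / (1 - s) ^ 2) ^ q * (v n / x ^ 2) ^ q with hB
  have hB0 : 0 ≤ B := by have := hv n; positivity
  calc P.real {ω | ∃ k < 2 ^ n, x < |f k ω - f 0 ω|}
      ≤ ∑ i ∈ Finset.range n, ∑ l ∈ Finset.range (2 ^ (n - i)), P.real
        {ω | lam i < |f ((l + 1) * 2 ^ i) ω - f (l * 2 ^ i) ω|} :=
        (measureReal_mono hsub (measure_ne_top _ _)).trans <| (measureReal_biUnion_finset_le _ _).trans <|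
          Finset.sum_le_sum fun i _ => measureReal_biUnion_finset_le _ _
    _ ≤ ∑ i ∈ Finset.range n, ∑ l ∈ Finset.range (2 ^ (n - i)), B * (1 / 4) ^ (n - i) :=
        Finset.sum_le_sum fun i hi => Finset.sum_le_sum fun l _ => hone i hi l
    _ = B * ∑ i ∈ Finset.range n, (1 / 2 : ℝ) ^ (n - i) := by
        rw [Finset.mul_sum]
        refine Finset.sum_congr rfl fun i _ => ?_
        rw [Finset.sum_const, Finset.card_range, nsmul_eq_mul, Nat.cast_pow, Nat.cast_ofNat,
          mul_left_comm, ← mul_pow]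
        norm_num
    _ ≤ B * 1 := by
        gcongr
        have h2 : ∑ i ∈ Finset.range n, (1 / 2 : ℝ) ^ (n - i) = 1 - (1 / 2) ^ n := by
          calc ∑ i ∈ Finset.range n, (1 / 2 : ℝ) ^ (n - i)
              = ∑ i ∈ Finset.range n, (1 / 2 : ℝ) ^ (n - 1 - i + 1) :=
                Finset.sum_congr rfl fun i hi => by
                  have := Finset.mem_range.1 hi
                  congr 1; omega
            _ = ∑ i ∈ Finset.range n, (1 / 2 : ℝ) ^ (i + 1) :=
                Finset.sum_range_reflect (fun i => (1 / 2 : ℝ) ^ (i + 1)) n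
            _ = 1 - (1 / 2) ^ n := by
                simp_rw [pow_succ]
                rw [← Finset.sum_mul, geom_sum_eq (by norm_num)]
                ring
        rw [h2]
        linarith [show (0 : ℝ) ≤ (1 / 2) ^ n by positivity]
    _ = B := mul_one B

/-! ### Variances under regular variation -/

theorem tendsto_ratio_of_regularlyVarying {V : ℕ → ℝ} {H : ℝ} {ℓ : ℝ → ℝ} (hℓ : IsSlowlyVarying ℓ)
    (hV : Tendsto (fun n : ℕ => V n / ((n : ℝ) ^ (2 * H) * ℓ n)) atTop (𝓝 1)) :
    Tendsto (fun n : ℕ => V (2 * n) / V n) atTop (𝓝 (2 ^ (2 * H))) := by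
  obtain ⟨⟨X, hX, -⟩, hlim⟩ := hℓ
  have h2 : Tendsto (fun n : ℕ => 2 * n) atTop atTop :=
    tendsto_id.const_mul_atTop' (by norm_num)
  have hc : Tendsto (fun n : ℕ => ℓ (2 * n) / ℓ n) atTop (𝓝 1) :=
    (hlim 2 two_pos).comp tendsto_natCast_atTop_atTop
  have hmain := (((hV.comp h2).div hV one_ne_zero).mul hc).mul_const ((2 : ℝ) ^ (2 * H))
  simp only [div_one, mul_one, one_mul] at hmain
  refine hmain.congr' ?_
  filter_upwards [eventually_ge_atTop 1, tendsto_natCast_atTop_atTop.eventually_ge_atTop X]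
    with n hn hXn
  have hn0 : (0 : ℝ) < n := by exact_mod_cast hn
  have h1 : 0 < ℓ n := hX _ hXn
  have h3 : 0 < ℓ (2 * n) := hX _ (by rw [Set.mem_Ici]; linarith)
  simp only [Pi.div_apply, Function.comp_apply, Nat.cast_mul, Nat.cast_ofNat]
  rw [Real.mul_rpow two_pos.le hn0.le]
  have h4 : (0 : ℝ) < 2 ^ (2 * H) := by positivity
  have h5 : (0 : ℝ) < (n : ℝ) ^ (2 * H) := by positivity
  by_cases hv : V n = 0
  · simp [hv]
  · field_simp

/-- A zero of `V` would propagate to all its dyadic multiples, along which the normalized sequence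
could then not tend to `1`. -/
theorem pos_of_tendsto_of_le_four_mul {V g : ℕ → ℝ} (h0 : ∀ n, 0 ≤ V n)
    (h4 : ∀ n, V (2 * n) ≤ 4 * V n) (hV : Tendsto (fun n => V n / g n) atTop (𝓝 1)) {m : ℕ}
    (hm : 1 ≤ m) : 0 < V m := by
  refine lt_of_le_of_ne (h0 m) fun hz => ?_
  have hz' : ∀ i, V (2 ^ i * m) = 0 := by
    intro i
    induction i with
    | zero => simp [← hz]
    | succ i ih =>
      have := h4 (2 ^ i * m)
      rw [ih, ← mul_assoc, ← pow_succ'] at this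
      exact le_antisymm (by linarith) (h0 _)
  have ht : Tendsto (fun i : ℕ => 2 ^ i * m) atTop atTop :=
    tendsto_atTop_mono (fun i => (Nat.lt_two_pow_self).le.trans (Nat.le_mul_of_pos_right _ hm))
      tendsto_id
  have h := hV.comp ht
  simp only [Function.comp_def, hz', zero_div] at h
  exact zero_ne_one (tendsto_nhds_unique tendsto_const_nhds h)

theorem exists_geometric_growth {v : ℕ → ℝ} {L ρ : ℝ} (hv : ∀ j, 0 < v j)
    (hlim : Tendsto (fun j => v (j + 1) / v j) atTop (𝓝 L)) (hρ : 0 < ρ) (hρL : ρ < L) :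
    ∃ C : ℝ, 0 < C ∧ ∀ n, ∀ i ≤ n, v i * ρ ^ (n - i) ≤ C * v n := by
  obtain ⟨N, hN⟩ := eventually_atTop.1 (hlim.eventually (lt_mem_nhds hρL))
  set F : ℕ → ℕ → ℝ := fun i n => v i * ρ ^ (n - i) / v n with hF
  have hF0 : ∀ i n, 0 ≤ F i n := fun i n => by have := hv i; have := hv n; positivity
  set S := ∑ i ∈ Finset.range (N + 1), ∑ n ∈ Finset.range (N + 1), F i n with hS
  have hS0 : 0 ≤ S := Finset.sum_nonneg fun i _ => Finset.sum_nonneg fun n _ => hF0 i n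
  refine ⟨1 + S, by linarith, fun n => ?_⟩
  induction n with
  | zero =>
    intro i hi
    obtain rfl : i = 0 := by omega
    have := hv 0
    rw [Nat.sub_self, pow_zero, mul_one]
    nlinarith
  | succ n ih =>
    intro i hi
    have hvn := hv (n + 1)
    rcases hi.eq_or_lt with rfl | hi
    · rw [Nat.sub_self, pow_zero, mul_one]
      nlinarith
    by_cases hn : N ≤ n
    · have h1 := ih i (by omega)
      have h2 := hN n hn
      rw [lt_div_iff₀ (hv n)] at h2
      rw [Nat.succ_sub (by omega), pow_succ]
      calc v i * (ρ ^ (n - i) * ρ) = v i * ρ ^ (n - i) * ρ := by ring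
        _ ≤ (1 + S) * v n * ρ := by gcongr
        _ = (1 + S) * (ρ * v n) := by ring
        _ ≤ (1 + S) * v (n + 1) := by gcongr
    · have h1 : F i (n + 1) ≤ S :=
        (Finset.single_le_sum (f := fun n => F i n) (fun n _ => hF0 i n)
          (Finset.mem_range.2 (by omega))).trans
        (Finset.single_le_sum (f := fun i => ∑ n ∈ Finset.range (N + 1), F i n)
          (fun i _ => Finset.sum_nonneg fun n _ => hF0 i n) (Finset.mem_range.2 (by omega)))
      rw [hF, div_le_iff₀ hvn] at h1
      linarith

/-! ### The upper bound -/

section Walk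

variable {Ω : Type*} [MeasurableSpace Ω] {P : Measure Ω} {ξ : ℤ → Ω → ℝ}

theorem measurableSet_forall_le_zero (N : ℕ) :
    MeasurableSet {x : ℤ → ℝ | ∀ n : ℤ, |n| ≤ (N : ℤ) → x n ≤ 0} := by
  have : {x : ℤ → ℝ | ∀ n : ℤ, |n| ≤ (N : ℤ) → x n ≤ 0} =
      ⋂ n : ℤ, ⋂ _ : |n| ≤ (N : ℤ), {x | x n ≤ 0} := by ext; simp
  rw [this]
  exact MeasurableSet.iInter fun n => MeasurableSet.iInter fun _ =>
    measurableSet_le (measurable_pi_apply n) measurable_const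

theorem IsStationarySeq.measureReal_localMax (hstat : IsStationarySeq ξ P) (N : ℕ) (k : ℤ) :
    P.real {ω | ∀ n : ℤ, |n| ≤ (N : ℤ) → walk ξ (k + n) ω - walk ξ k ω ≤ 0} =
      P.real {ω | ∀ n : ℤ, |n| ≤ (N : ℤ) → walk ξ n ω ≤ 0} :=
  congrArg ENNReal.toReal
    ((hstat.identDistrib_walk k).measure_mem_eq (measurableSet_forall_le_zero N))

theorem persistence_le_inv [IsProbabilityMeasure P] (hgauss : IsGaussianProcess ξ P)
    (hcent : ∀ n : ℤ, ∫ ω, ξ n ω ∂P = 0) (hstat : IsStationarySeq ξ P)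
    (hpos : ∀ n : ℕ, 1 ≤ n → 0 < Var[walk ξ n; P]) {N : ℕ} (hN : 1 ≤ N) :
    P.real {ω | ∀ n : ℤ, |n| ≤ (N : ℤ) → walk ξ n ω ≤ 0} ≤ (N : ℝ)⁻¹ := by
  set E : ℕ → Set Ω := fun k =>
    {ω | ∀ n : ℤ, |n| ≤ (N : ℤ) → walk ξ (k + n) ω - walk ξ k ω ≤ 0} with hE
  have hnull : ∀ k, NullMeasurableSet (E k) P := fun k =>
    (hstat.identDistrib_walk k).aemeasurable_fst.nullMeasurable
      (measurableSet_forall_le_zero N)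
  have hdisj : ∀ i ∈ Finset.range N, ∀ j ∈ Finset.range N, i < j → AEDisjoint P (E i) (E j) := by
    intro i hi j hj hij
    rw [Finset.mem_range] at hi hj
    -- two maxima over windows containing both points can only coexist if they are equal
    have hsub : E i ∩ E j ⊆ (fun ω => walk ξ j ω - walk ξ i ω) ⁻¹' {0} := by
      rintro ω ⟨h1, h2⟩
      have h1' := h1 (j - i) (abs_le.2 ⟨by omega, by omega⟩)
      have h2' := h2 (i - j) (abs_le.2 ⟨by omega, by omega⟩)
      rw [add_sub_cancel] at h1' h2'
      exact le_antisymm h1' (by linarith)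
    refine measure_mono_null hsub ?_
    have hlaw := map_walk_sub hgauss hcent hstat j i
    have hv := hpos ((j : ℤ) - i).natAbs (by omega)
    have := nullSingletonClass_gaussianReal (μ := 0) (Real.toNNReal_pos.2 hv).ne'
    have hae : AEMeasurable (fun ω => walk ξ j ω - walk ξ i ω) P :=
      ((isGaussianProcess_walk hgauss).hasGaussianLaw_fun_sub).aemeasurable
    rw [← Measure.map_apply_of_aemeasurable hae (measurableSet_singleton 0), hlaw,
      measure_singleton]
  have hpair : (Finset.range N : Set ℕ).Pairwise (Function.onFun (AEDisjoint P) E) := by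
    intro i hi j hj hij
    rcases lt_or_gt_of_ne hij with h | h
    · exact hdisj i hi j hj h
    · exact (hdisj j hj i hi h).symm
  have hsum : ∑ k ∈ Finset.range N, P.real (E k) ≤ 1 := by
    simp only [measureReal_def]
    rw [← ENNReal.toReal_sum fun _ _ => measure_ne_top _ _,
      ← measure_biUnion_finset₀ hpair fun k _ => hnull k]
    exact measureReal_le_one
  have hE' : ∀ k, P.real (E k) = P.real {ω | ∀ n : ℤ, |n| ≤ (N : ℤ) → walk ξ n ω ≤ 0} :=
    fun k => hstat.measureReal_localMax N k
  simp only [hE', Finset.sum_const, Finset.card_range, nsmul_eq_mul] at hsum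
  rwa [← one_div, le_div_iff₀' (by exact_mod_cast hN)]

/-! ### The lower bound -/

/-- With probability bounded below, the walk at time `m` exceeds both of its values at `0` and `2m`
by the standard deviation of `walk ξ (2 * m)`. -/
theorem exists_midpoint_bound (hgauss : IsGaussianProcess ξ P)
    (hcent : ∀ n : ℤ, ∫ ω, ξ n ω ∂P = 0) (hstat : IsStationarySeq ξ P) {κ : ℝ} (hκ : 0 < κ) :
    ∃ δ : ℝ, 0 < δ ∧ ∀ m : ℕ, 0 < Var[walk ξ (2 * m); P] →
      (1 + κ) * Var[walk ξ (2 * m); P] ≤ 4 * Var[walk ξ m; P] →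
      δ ≤ P.real {ω | |walk ξ (2 * m) ω| + 2 * √Var[walk ξ (2 * m); P] <
        2 * walk ξ m ω - walk ξ (2 * m) ω} := by
  have hP := hgauss.isProbabilityMeasure
  have hw := isGaussianProcess_walk hgauss
  refine ⟨(gaussianReal 0 1).real (Set.Ioi (3 / √κ)) * (gaussianReal 0 1).real (Set.Ioo (-1) 1),
    mul_pos (gaussianReal_real_pos_of_isOpen isOpen_Ioi Set.nonempty_Ioi)
      (gaussianReal_real_pos_of_isOpen isOpen_Ioo (Set.nonempty_Ioo.2 (by norm_num))), ?_⟩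
  intro m hpos hle
  set t := Var[walk ξ (2 * m); P] with ht
  set D : Ω → ℝ := fun ω => 2 * walk ξ m ω - walk ξ (2 * m) ω with hD
  have hst : 0 < √t := Real.sqrt_pos.2 hpos
  have hTlaw : P.map (walk ξ (2 * m)) = gaussianReal 0 t.toNNReal := by
    rw [(hw.hasGaussianLaw_eval (2 * m)).map_eq_gaussianReal, integral_walk hgauss hcent]
  have hDG : HasGaussianLaw D P :=
    (hw.hasGaussianLaw_prodMk (s := (m : ℤ)) (t := 2 * (m : ℤ))).map
      ((2 : ℝ) • ContinuousLinearMap.fst ℝ ℝ ℝ - ContinuousLinearMap.snd ℝ ℝ ℝ)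
  have hDmean : ∫ ω, D ω ∂P = 0 := by
    rw [hD, integral_sub ((hw.hasGaussianLaw_eval m).integrable.const_mul 2)
      (hw.hasGaussianLaw_eval _).integrable, integral_const_mul, integral_walk hgauss hcent,
      integral_walk hgauss hcent]
    simp
  have hDlaw : P.map D = gaussianReal 0 (4 * Var[walk ξ m; P] - t).toNNReal := by
    rw [hDG.map_eq_gaussianReal, hDmean, variance_walk_midpoint hgauss hstat]
  set d := 4 * Var[walk ξ m; P] - t with hd
  have hκd : κ * t ≤ d := by rw [hd]; linarith
  have hd0 : 0 ≤ d := (by positivity : 0 ≤ κ * t).trans hκd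
  have hT : (gaussianReal 0 1).real (Set.Ioo (-1) 1) ≤
      P.real (walk ξ (2 * m) ⁻¹' Set.Ioo (-√t) √t) := by
    rw [← map_measureReal_apply_of_aemeasurable (hw.hasGaussianLaw_eval _).aemeasurable
      measurableSet_Ioo, hTlaw, gaussianReal_eq_map_sqrt hpos.le,
      map_measureReal_apply (by fun_prop) measurableSet_Ioo]
    refine measureReal_mono (fun z hz => ?_) (measure_ne_top _ _)
    simp only [Set.mem_preimage, Set.mem_Ioo] at hz ⊢
    constructor <;> nlinarith
  have hDD : (gaussianReal 0 1).real (Set.Ioi (3 / √κ)) ≤ P.real (D ⁻¹' Set.Ioi (3 * √t)) := by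
    rw [← map_measureReal_apply_of_aemeasurable hDG.aemeasurable measurableSet_Ioi, hDlaw,
      gaussianReal_eq_map_sqrt hd0, map_measureReal_apply (by fun_prop) measurableSet_Ioi]
    refine measureReal_mono (fun z hz => ?_) (measure_ne_top _ _)
    simp only [Set.mem_preimage, Set.mem_Ioi] at hz ⊢
    have h1 : √κ * √t ≤ √d := by rw [← Real.sqrt_mul hκ.le]; exact Real.sqrt_le_sqrt hκd
    have hsκ : 0 < √κ := Real.sqrt_pos.2 hκ
    rw [div_lt_iff₀ hsκ] at hz
    have hz0 : 0 < z := by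
      by_contra hcon
      nlinarith
    calc 3 * √t < z * √κ * √t := by gcongr
      _ = √κ * √t * z := by ring
      _ ≤ √d * z := by gcongr
  have hind : P.real (D ⁻¹' Set.Ioi (3 * √t) ∩ walk ξ (2 * m) ⁻¹' Set.Ioo (-√t) √t) =
      P.real (D ⁻¹' Set.Ioi (3 * √t)) * P.real (walk ξ (2 * m) ⁻¹' Set.Ioo (-√t) √t) := by
    simp only [measureReal_def]
    rw [(indepFun_walk_midpoint hgauss hstat m).measure_inter_preimage_eq_mul _ _
      measurableSet_Ioi measurableSet_Ioo, ENNReal.toReal_mul]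
  calc _ ≤ P.real (D ⁻¹' Set.Ioi (3 * √t)) * P.real (walk ξ (2 * m) ⁻¹' Set.Ioo (-√t) √t) := by
        gcongr
    _ = P.real (D ⁻¹' Set.Ioi (3 * √t) ∩ walk ξ (2 * m) ⁻¹' Set.Ioo (-√t) √t) := hind.symm
    _ ≤ _ := by
        refine measureReal_mono (fun ω hω => ?_) (measure_ne_top _ _)
        obtain ⟨h1, h2⟩ := hω
        simp only [Set.mem_preimage, Set.mem_Ioi, Set.mem_Ioo] at h1 h2
        have := abs_lt.2 h2
        simp only [Set.mem_ofPred_eq]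
        linarith

/-- By `hmid`, which says that `2 * S m - S (2 * m) > |S (2 * m)| + 2 * x`, the path exceeds at the
midpoint both `0` and `S (2 * m)` by more than `x`. If it stays within `x` of these values up to
distance `r` from the endpoints, its maximum over `[0, 2m]` is attained at distance at least `r`
from the endpoints. -/
theorem exists_localMax_of_midpoint {S : ℤ → ℝ} {x : ℝ} {m r : ℕ} (hr : 0 < r)
    (hmid : |S (2 * m)| + 2 * x < 2 * S m - S (2 * m))
    (hl : ∀ k < r, |S k| ≤ x) (hu : ∀ k < r, |S (2 * m - k) - S (2 * m)| ≤ x) :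
    ∃ k < 2 * m, ∀ n : ℤ, |n| ≤ (r : ℤ) → S (k + n) - S k ≤ 0 := by
  obtain ⟨k, hk, hmax⟩ := Finset.exists_max_image (Finset.range (2 * m + 1)) (fun k => S (k : ℤ))
    ⟨0, by simp⟩
  rw [Finset.mem_range] at hk
  have hkm := hmax m (by rw [Finset.mem_range]; omega)
  have habs := abs_nonneg (S (2 * m))
  have hself := le_abs_self (S (2 * m))
  have hneg := neg_abs_le (S (2 * m))
  have h1 : r ≤ k := by
    by_contra hcon
    have := (abs_le.1 (hl k (by omega))).2
    linarith
  have h2 : k + r ≤ 2 * m := by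
    by_contra hcon
    have := (abs_le.1 (hu (2 * m - k) (by omega))).2
    rw [show 2 * (m : ℤ) - ((2 * m - k : ℕ) : ℤ) = k by omega] at this
    linarith
  refine ⟨k, by omega, fun n hn => ?_⟩
  rw [abs_le] at hn
  have := hmax (k + n).toNat (by rw [Finset.mem_range]; omega)
  rw [show (((k + n).toNat : ℕ) : ℤ) = k + n by omega] at this
  linarith

theorem persistence_antitone [IsProbabilityMeasure P] {M N : ℕ} (h : M ≤ N) :
    P.real {ω | ∀ n : ℤ, |n| ≤ (N : ℤ) → walk ξ n ω ≤ 0} ≤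
      P.real {ω | ∀ n : ℤ, |n| ≤ (M : ℤ) → walk ξ n ω ≤ 0} :=
  measureReal_mono (fun _ hω n hn => hω n (hn.trans (by exact_mod_cast h))) (measure_ne_top _ _)

/-- The lower bound along powers of two: if the variances at dyadic times grow geometrically with
limiting ratio strictly between `1` and `4`, the walk has with probability bounded below its maximum
over `[0, 2 ^ (n + e)]` at distance at least `2 ^ n` from the endpoints; summing over the position of
that maximum gives the bound. -/
theorem exists_dyadic_persistence_ge (hgauss : IsGaussianProcess ξ P)
    (hcent : ∀ n : ℤ, ∫ ω, ξ n ω ∂P = 0) (hstat : IsStationarySeq ξ P)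
    (hpos : ∀ n : ℕ, 1 ≤ n → 0 < Var[walk ξ n; P]) {L : ℝ} (hL1 : 1 < L) (hL4 : L < 4)
    (hlim : Tendsto (fun j : ℕ =>
      Var[walk ξ (2 ^ (j + 1) : ℕ); P] / Var[walk ξ (2 ^ j : ℕ); P]) atTop (𝓝 L)) :
    ∃ a : ℝ, 0 < a ∧ ∃ n₀ : ℕ, ∀ n ≥ n₀,
      a ≤ 2 ^ n * P.real {ω | ∀ k : ℤ, |k| ≤ ((2 ^ n : ℕ) : ℤ) → walk ξ k ω ≤ 0} := by
  have hP := hgauss.isProbabilityMeasure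
  set v : ℕ → ℝ := fun j => Var[walk ξ (2 ^ j : ℕ); P] with hv
  have hv0 : ∀ j, 0 < v j := fun j => hpos _ Nat.one_le_two_pow
  obtain ⟨ρ, hρ1, hρL⟩ := exists_between hL1
  obtain ⟨C, hC, hvC⟩ := exists_geometric_growth hv0 hlim (by linarith) hρL
  obtain ⟨q, A, hq, hA, hchain⟩ := exists_chaining_bound hρ1 hC
  obtain ⟨L', hLL', hL'4⟩ := exists_between hL4
  have hL'0 : 0 < L' := by linarith
  have hκ : 0 < 4 / L' - 1 := by
    rw [sub_pos, lt_div_iff₀ hL'0]; linarith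
  obtain ⟨δ, hδ, hmid⟩ := exists_midpoint_bound hgauss hcent hstat hκ
  obtain ⟨j₀, hj₀⟩ := eventually_atTop.1 (hlim.eventually (gt_mem_nhds hLL'))
  -- the boundary layers have relative length `2 ^ (-e)`; `e` is taken so large that the walk moves
  -- there by more than a standard deviation with probability at most `δ / 4`
  obtain ⟨e, he1, heδ⟩ : ∃ e : ℕ, 1 ≤ e ∧ A * (C * (1 / ρ) ^ e) ^ q < δ / 4 := by
    have h1 : Tendsto (fun e : ℕ => A * (C * (1 / ρ) ^ e) ^ q) atTop (𝓝 (A * (C * 0) ^ q)) :=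
      (((tendsto_pow_atTop_nhds_zero_of_lt_one (by positivity)
        (by rw [div_lt_one (by linarith)]; exact hρ1)).const_mul C).pow q).const_mul A
    rw [mul_zero, zero_pow hq, mul_zero] at h1
    have h2 := h1.eventually (gt_mem_nhds (show 0 < δ / 4 by linarith))
    exact ((eventually_ge_atTop 1).and h2).exists
  refine ⟨δ / 2 / 2 ^ e, by positivity, j₀, fun n hn => ?_⟩
  set m : ℕ := 2 ^ (n + e - 1) with hm
  have hm2 : 2 * m = 2 ^ (n + e) := by rw [hm, ← pow_succ']; congr 1; omega
  have hm2' : (2 * (m : ℤ)) = ((2 ^ (n + e) : ℕ) : ℤ) := by rw [← hm2]; push_cast; ring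
  have hVt : Var[walk ξ (2 * m); P] = v (n + e) := by rw [hm2']
  have hVm : Var[walk ξ m; P] = v (n + e - 1) := rfl
  have hratio := hj₀ (n + e - 1) (by omega)
  rw [div_lt_iff₀ (hv0 _), show n + e - 1 + 1 = n + e by omega] at hratio
  have hG := hmid m (by rw [hVt]; exact hv0 _) (by
    rw [hVt, hVm, add_sub_cancel, div_mul_eq_mul_div, div_le_iff₀ hL'0]
    change v (n + e) < L' * v (n + e - 1) at hratio
    linarith)
  rw [hVt] at hG
  set x := √(v (n + e)) with hx
  have hx0 : 0 < x := Real.sqrt_pos.2 (hv0 _)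
  have hxv : v n / x ^ 2 ≤ C * (1 / ρ) ^ e := by
    have h1 := hvC (n + e) n (by omega)
    rw [hx, Real.sq_sqrt (hv0 _).le, div_le_iff₀ (hv0 _), one_div, inv_pow]
    rw [Nat.add_sub_cancel_left] at h1
    have hρe : 0 < ρ ^ e := by positivity
    rw [mul_right_comm, ← div_eq_mul_inv, le_div_iff₀ hρe]
    exact h1
  have hsmall : A * (v n / x ^ 2) ^ q ≤ δ / 4 := by
    have h0 : 0 ≤ v n / x ^ 2 := by have := hv0 n; positivity
    refine le_trans ?_ heδ.le
    gcongr
  have hlaw : ∀ a b : ℤ, ∀ i : ℕ, (a - b).natAbs = 2 ^ i →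
      P.map (fun ω => walk ξ a ω - walk ξ b ω) = gaussianReal 0 (v i).toNNReal := by
    intro a b i hi
    rw [map_walk_sub hgauss hcent hstat, hi]
  have hb1 := (hchain P (fun k => walk ξ (k : ℤ)) v n hv0 (hvC n) (fun i l => hlaw _ _ i (by
    rw [add_mul, one_mul]; push_cast; rw [add_sub_cancel_left]; norm_cast)) x hx0).trans hsmall
  have hb2 := (hchain P (fun k => walk ξ (2 * m - (k : ℤ))) v n hv0 (hvC n)
    (fun i l => hlaw _ _ i (by
      rw [add_mul, one_mul]; push_cast; rw [sub_sub_sub_cancel_left, sub_add_cancel_left,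
        Int.natAbs_neg]; norm_cast)) x hx0).trans hsmall
  set G := {ω | |walk ξ (2 * m) ω| + 2 * x < 2 * walk ξ m ω - walk ξ (2 * m) ω}
  set B₁ := {ω | ∃ k < 2 ^ n, x < |walk ξ (k : ℕ) ω - walk ξ (0 : ℕ) ω|}
  set B₂ := {ω | ∃ k < 2 ^ n, x < |walk ξ (2 * m - (k : ℕ)) ω - walk ξ (2 * m - (0 : ℕ)) ω|}
  set E : ℕ → Set Ω := fun k =>
    {ω | ∀ i : ℤ, |i| ≤ ((2 ^ n : ℕ) : ℤ) → walk ξ (k + i) ω - walk ξ k ω ≤ 0} with hE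
  have hsub : G ⊆ (B₁ ∪ B₂) ∪ ⋃ k ∈ Finset.range (2 * m), E k := by
    intro ω hω
    by_cases h1 : ω ∈ B₁
    · exact Or.inl (Or.inl h1)
    by_cases h2 : ω ∈ B₂
    · exact Or.inl (Or.inr h2)
    refine Or.inr ?_
    simp only [B₁, B₂, Set.mem_ofPred_eq, not_exists, not_and, not_lt, Nat.cast_zero, walk_zero,
      sub_zero] at h1 h2
    obtain ⟨k, hk, hmax⟩ := exists_localMax_of_midpoint (S := fun k => walk ξ k ω)
      (by positivity : 0 < 2 ^ n) hω h1 h2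
    exact Set.mem_biUnion (Finset.mem_coe.2 (Finset.mem_range.2 hk)) hmax
  have hE' : ∀ k, P.real (E k) =
      P.real {ω | ∀ k : ℤ, |k| ≤ ((2 ^ n : ℕ) : ℤ) → walk ξ k ω ≤ 0} :=
    fun k => hstat.measureReal_localMax _ k
  set p := P.real {ω | ∀ k : ℤ, |k| ≤ ((2 ^ n : ℕ) : ℤ) → walk ξ k ω ≤ 0}
  have hU : P.real (⋃ k ∈ Finset.range (2 * m), E k) ≤ 2 ^ (n + e) * p := by
    refine (measureReal_biUnion_finset_le _ _).trans_eq ?_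
    simp only [hE', Finset.sum_const, Finset.card_range, nsmul_eq_mul, hm2]
    push_cast
    rfl
  have htot : δ ≤ δ / 4 + δ / 4 + 2 ^ (n + e) * p :=
    calc δ ≤ P.real G := hG
      _ ≤ P.real ((B₁ ∪ B₂) ∪ ⋃ k ∈ Finset.range (2 * m), E k) :=
        measureReal_mono hsub (measure_ne_top _ _)
      _ ≤ P.real B₁ + P.real B₂ + P.real (⋃ k ∈ Finset.range (2 * m), E k) :=
        (measureReal_union_le _ _).trans (add_le_add (measureReal_union_le _ _) le_rfl)
      _ ≤ _ := add_le_add (add_le_add hb1 hb2) hU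
  rw [div_le_iff₀ (by positivity)]
  rw [pow_add] at htot
  linarith

end Walk

theorem mainTheorem2 {Ω : Type*} [MeasurableSpace Ω] (P : Measure Ω) [IsProbabilityMeasure P]
    (ξ : ℤ → Ω → ℝ) (hgauss : IsGaussianProcess ξ P) (hcent : ∀ n : ℤ, ∫ ω, ξ n ω ∂P = 0)
    (hstat : IsStationarySeq ξ P)
    (H : ℝ) (hH0 : 0 < H) (hH1 : H < 1) (ℓ : ℝ → ℝ) (hℓ : IsSlowlyVarying ℓ)
    (hvar : Tendsto
      (fun n : ℕ =>
        (∑ j ∈ Finset.Icc 1 n, ∑ k ∈ Finset.Icc 1 n, ∫ ω, ξ (j : ℤ) ω * ξ (k : ℤ) ω ∂P) /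
          ((n : ℝ) ^ (2 * H) * ℓ (n : ℝ)))
      atTop (𝓝 1)) :
    ∃ c : ℝ, 0 < c ∧ ∀ N : ℕ, 1 ≤ N →
      c⁻¹ * (N : ℝ)⁻¹ ≤ P.real {ω | ∀ n : ℤ, |n| ≤ (N : ℤ) → walk ξ n ω ≤ 0} ∧
        P.real {ω | ∀ n : ℤ, |n| ≤ (N : ℤ) → walk ξ n ω ≤ 0} ≤ (N : ℝ)⁻¹ := by
  simp_rw [← variance_walk_eq_sum hgauss hcent] at hvar
  have hpos : ∀ n : ℕ, 1 ≤ n → 0 < Var[walk ξ n; P] := fun n hn =>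
    pos_of_tendsto_of_le_four_mul (V := fun n : ℕ => Var[walk ξ n; P])
      (fun n => variance_nonneg _ _) (fun n => by
        have h1 := variance_walk_midpoint hgauss hstat n
        have h2 := variance_nonneg (fun ω => 2 * walk ξ n ω - walk ξ (2 * n) ω) P
        push_cast
        linarith) hvar hn
  have hratio := (tendsto_ratio_of_regularlyVarying hℓ hvar).comp
    (tendsto_pow_atTop_atTop_of_one_lt (r := 2) (by norm_num : 1 < 2))
  simp only [Function.comp_def, ← pow_succ'] at hratio
  have hL1 : (1 : ℝ) < 2 ^ (2 * H) := Real.one_lt_rpow (by norm_num) (by linarith)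
  have hL4 : (2 : ℝ) ^ (2 * H) < 4 := by
    calc (2 : ℝ) ^ (2 * H) < 2 ^ (2 : ℝ) :=
          Real.rpow_lt_rpow_of_exponent_lt (by norm_num) (by linarith)
      _ = 4 := by norm_num
  obtain ⟨a, ha, n₀, hn₀⟩ := exists_dyadic_persistence_ge hgauss hcent hstat hpos hL1 hL4 hratio
  refine ⟨2 ^ (n₀ + 1) / a, by positivity, fun N hN =>
    ⟨?_, persistence_le_inv hgauss hcent hstat hpos hN⟩⟩
  -- `N ≤ 2 ^ n ≤ 2 ^ (n₀ + 1) * N` for this `n ≥ n₀`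
  set n := n₀ + (Nat.log 2 N + 1) with hn
  have h1 : N ≤ 2 ^ n :=
    (Nat.lt_pow_succ_log_self (by norm_num) N).le.trans (Nat.pow_le_pow_right (by norm_num) (by omega))
  have h2 : 2 ^ n ≤ 2 ^ (n₀ + 1) * N := by
    rw [hn, show n₀ + (Nat.log 2 N + 1) = n₀ + 1 + Nat.log 2 N by ring, pow_add]
    exact Nat.mul_le_mul_left _ (Nat.pow_log_le_self 2 (by omega))
  have h2' : (2 : ℝ) ^ n ≤ 2 ^ (n₀ + 1) * N := by exact_mod_cast h2
  have h3 := hn₀ n (by omega)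
  have hN0 : (0 : ℝ) < N := by exact_mod_cast hN
  refine le_trans ?_ (persistence_antitone (P := P) (ξ := ξ) h1)
  set p := P.real {ω | ∀ k : ℤ, |k| ≤ ((2 ^ n : ℕ) : ℤ) → walk ξ k ω ≤ 0}
  have hp : 0 ≤ p := measureReal_nonneg
  rw [inv_div, ← div_eq_mul_inv, div_div, div_le_iff₀ (by positivity)]
  calc a ≤ 2 ^ n * p := h3
    _ ≤ 2 ^ (n₀ + 1) * N * p := by gcongr
    _ = p * (2 ^ (n₀ + 1) * N) := mul_comm _ _
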